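/- Let $p\in[1,\infty)$, let $G$ be a countable discrete group, and let $A$ be a separable $L^p$ operator algebra, that is, a separable complex Banach algebra (not necessarily unital) which has an isometric representation on some space $L^p(X,\mu)$; here a representation of $A$ on a Banach space $E$ is an algebra homomorphism $A\to\mathcal B(E)$. Let $\alpha$ be an action of $G$ on $A$ by isometric automorphisms. Assume that $A$ has unique $L^p$ operator matrix norms: whenever $\mu,\nu$ are $\sigma$-finite measures on $X,Y$ with $L^p(X,\mu)$ and $L^p(Y,\nu)$ separable, and $\pi:A\to\mathcal B(L^p(X,\mu))$, $\sigma:A\to\mathcal B(L^p(Y,\nu))$ are isometric representations, then for all $n$ and all $(a_{ij})\in M_n(A)$ the operators $(\pi(a_{ij}))_{i,j}$ on $L^p(\{1,\dots,n\}\times X)$ and $(\sigma(a_{ij}))_{i,j}$ on $L^p(\{1,\dots,n\}\times Y)$ (with counting measure on $\{1,\dots,n\}$) have the same norm. Let $C_c(G,A,\alpha)$ be the algebra of finitely supported functions $f:G\to A$ with product $(f*g)(t)=\sum_{s\in G}f(s)\,\alpha_s(g(s^{-1}t))$. For a contractive representation $\pi_0$ of $A$ on $E_0$, put, for $a\in A$,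 $s,t\in G$ and $\xi\in l^p(G,E_0)$, $$(\pi(a)\xi)(s)=\pi_0(\alpha_{s^{-1}}(a))(\xi(s)),\qquad (\lambda_p^{E_0}(s)\xi)(t)=\xi(s^{-1}t),\qquad (\pi\rtimes\lambda_p^{E_0})(f)=\sum_{s\in G}\pi(f(s))\,\lambda_p^{E_0}(s)\quad(f\in C_c(G,A,\alpha)).$$ Call $\pi_0$ nondegenerate if the linear span of $\pi_0(A)E_0$ is dense in $E_0$. Let $F^p_\lambda(G,A,\alpha)$ be the Banach algebra obtained by completing $C_c(G,A,\alpha)$ in $\|f\|=\sup\|(\pi\rtimes\lambda_p^{E_0})(f)\|$, where the supremum is over all nondegenerate contractive representations $\pi_0$ of $A$ on spaces $E_0=L^p(X,\mu)$ with $\mu$ $\sigma$-finite. Let $\pi_0:A\to\mathcal B(E_0)$ be a nondegenerate isometric representation of $A$ on a space $E_0=L^p(X,\mu)$ with $\mu$ $\sigma$-finite. Then $\pi\rtimes\lambda_p^{E_0}$ extends to an isometric representation $F^p_\lambda(G,A,\alpha)\to\mathcal B(l^p(G,E_0))$. -/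

import Mathlib

open MeasureTheory
open scoped ENNReal

universe u v w

noncomputable section

namespace LpCrossed

/-! ### Actions and representations -/

/-- An isometric action of a discrete group `G` on a complex normed algebra `A`: a group
homomorphism from `G` to the isometric algebra automorphisms of `A` (each `α s` is bijective, with
inverse `α s⁻¹`). As `G` is discrete there is no continuity condition. -/
structure IsometricAction (G : Type v) (A : Type w) [Group G] [NonUnitalNormedRing A]
    [NormedSpace ℂ A] where
  toFun : G → A →ₙₐ[ℂ] A
  map_one' : ∀ a : A, toFun 1 a = a
  map_mul' : ∀ (s t : G) (a : A), toFun (s * t) a = toFun s (toFun t a)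
  norm_map' : ∀ (s : G) (a : A), ‖toFun s a‖ = ‖a‖

instance {G : Type v} {A : Type w} [Group G] [NonUnitalNormedRing A] [NormedSpace ℂ A] :
    CoeFun (IsometricAction G A) (fun _ => G → A →ₙₐ[ℂ] A) :=
  ⟨IsometricAction.toFun⟩

/-- A contractive representation of `A` on `E`: an algebra homomorphism `A → B(E)` that does not
increase the norm. Neither `A` nor the homomorphism need be unital. -/
structure ContractiveRep (A : Type w) (E : Type u) [NonUnitalNormedRing A] [NormedSpace ℂ A]
    [NormedAddCommGroup E] [NormedSpace ℂ E] where
  hom : A →ₙₐ[ℂ] (E →L[ℂ] E)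
  norm_le : ∀ a : A, ‖hom a‖ ≤ ‖a‖

namespace ContractiveRep

variable {A : Type w} {E : Type u} [NonUnitalNormedRing A] [NormedSpace ℂ A]
  [NormedAddCommGroup E] [NormedSpace ℂ E]

/-- The representation is isometric. -/
def IsIsometric (π : ContractiveRep A E) : Prop := ∀ a : A, ‖π.hom a‖ = ‖a‖

/-- The linear span of `{π(a) ξ : a ∈ A, ξ ∈ E}` is dense in `E`. -/
def Nondegenerate (π : ContractiveRep A E) : Prop :=
  Dense (Submodule.span ℂ {η : E | ∃ (a : A) (ξ : E), π.hom a ξ = η} : Set E)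

/-- The zero representation. -/
def zero (A : Type w) (E : Type u) [NonUnitalNormedRing A] [NormedSpace ℂ A]
    [NormedAddCommGroup E] [NormedSpace ℂ E] : ContractiveRep A E where
  hom := 0
  norm_le a := by simp

end ContractiveRep

/-- `A` is an `L^p` operator algebra: a Banach algebra (completeness is a hypothesis on `A`) with an
isometric representation on some space `L^p(X, μ)`. -/
def IsLpOperatorAlgebra (p : ℝ≥0∞) [Fact (1 ≤ p)] (A : Type w) [NonUnitalNormedRing A]
    [NormedSpace ℂ A] : Prop :=
  ∃ (X : Type u) (_ : MeasurableSpace X) (μ : Measure X) (π : ContractiveRep A (Lp ℂ p μ)),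
    π.IsIsometric

/-! ### Matrix norms -/

/-- The amplification of `π` to `n × n` matrices over `A`, acting on the `ℓ^p` direct sum of `n`
copies of `E` by `(ξ_j)_j ↦ (∑_j π(a_{ij}) ξ_j)_i`. For `E = L^p(X, μ)` this direct sum is
`L^p({1, …, n} × X, ν × μ)` with `ν` the counting measure. -/
def amplify (p : ℝ≥0∞) [Fact (1 ≤ p)] {A : Type w} {E : Type u} [NonUnitalNormedRing A]
    [NormedSpace ℂ A] [NormedAddCommGroup E] [NormedSpace ℂ E] (π : ContractiveRep A E) {n : ℕ}
    (a : Matrix (Fin n) (Fin n) A) :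
    PiLp p (fun _ : Fin n => E) →L[ℂ] PiLp p (fun _ : Fin n => E) :=
  ((PiLp.continuousLinearEquiv p ℂ (fun _ : Fin n => E)).symm :
      (Fin n → E) →L[ℂ] PiLp p (fun _ : Fin n => E)) ∘L
    (ContinuousLinearMap.pi fun i => ∑ j, π.hom (a i j) ∘L ContinuousLinearMap.proj j) ∘L
    (PiLp.continuousLinearEquiv p ℂ (fun _ : Fin n => E) :
      PiLp p (fun _ : Fin n => E) →L[ℂ] (Fin n → E))

theorem amplify_apply (p : ℝ≥0∞) [Fact (1 ≤ p)] {A : Type w} {E : Type u} [NonUnitalNormedRing A]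
    [NormedSpace ℂ A] [NormedAddCommGroup E] [NormedSpace ℂ E] (π : ContractiveRep A E) {n : ℕ}
    (a : Matrix (Fin n) (Fin n) A) (ξ : PiLp p (fun _ : Fin n => E)) (i : Fin n) :
    amplify p π a ξ i = ∑ j, π.hom (a i j) (ξ j) := by
  simp [amplify]

/-- `A` has unique `L^p` operator matrix norms: for any two isometric representations `π`, `σ` on
separable `L^p` spaces of `σ`-finite measures, `σ ∘ π⁻¹ : π(A) → σ(A)` is completely isometric. -/
def HasUniqueLpMatrixNorms (p : ℝ≥0∞) [Fact (1 ≤ p)] (A : Type w) [NonUnitalNormedRing A]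
    [NormedSpace ℂ A] : Prop :=
  ∀ (X Y : Type u) [MeasurableSpace X] [MeasurableSpace Y] (μ : Measure X) (ν : Measure Y)
    [SigmaFinite μ] [SigmaFinite ν] [TopologicalSpace.SeparableSpace (Lp ℂ p μ)]
    [TopologicalSpace.SeparableSpace (Lp ℂ p ν)]
    (π : ContractiveRep A (Lp ℂ p μ)) (σ : ContractiveRep A (Lp ℂ p ν)),
    π.IsIsometric → σ.IsIsometric →
      ∀ (n : ℕ) (a : Matrix (Fin n) (Fin n) A), ‖amplify p σ a‖ = ‖amplify p π a‖

/-! ### Regular covariant representations -/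

/-- The space `l^p(G, E)`. -/
abbrev lpG (p : ℝ≥0∞) (G : Type v) (E : Type u) [NormedAddCommGroup E] : Type (max v u) :=
  lp (fun _ : G => E) p

theorem memlp_comp_equiv (p : ℝ≥0∞) {G : Type v} {E : Type u} [NormedAddCommGroup E]
    (e : G ≃ G) (ξ : lpG p G E) : Memℓp (fun t => ξ (e t)) p := by
  have h := lp.memℓp ξ
  obtain (rfl | rfl | hp') := p.trichotomy
  · rw [memℓp_zero_iff] at h ⊢
    exact h.preimage e.injective.injOn
  · rw [memℓp_infty_iff] at h ⊢
    exact h.mono (Set.range_comp_subset_range e fun t => ‖ξ t‖)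
  · rw [memℓp_gen_iff hp'] at h ⊢
    exact (e.summable_iff (f := fun t => ‖ξ t‖ ^ p.toReal)).2 h

section Regular

variable (p : ℝ≥0∞) [Fact (1 ≤ p)] {G : Type v} {A : Type w} {E : Type u} [Group G]
  [NonUnitalNormedRing A] [NormedSpace ℂ A] [NormedAddCommGroup E] [NormedSpace ℂ E]

theorem ne_zero_of_fact (p : ℝ≥0∞) [hp : Fact (1 ≤ p)] : p ≠ 0 := fun h => by
  have := hp.out
  simp [h] at this

theorem norm_regPi_apply_le (α : IsometricAction G A) (π₀ : ContractiveRep A E) (a : A) (s : G)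
    (x : E) : ‖π₀.hom (α s⁻¹ a) x‖ ≤ ‖a‖ * ‖x‖ :=
  (ContinuousLinearMap.le_opNorm _ _).trans
    (mul_le_mul_of_nonneg_right ((π₀.norm_le _).trans (α.norm_map' _ _).le) (norm_nonneg _))

/-- The operator `π(a)` on `l^p(G, E)`, `(π(a) ξ)(s) = π₀(α_{s⁻¹}(a)) (ξ(s))`. -/
def regPi (α : IsometricAction G A) (π₀ : ContractiveRep A E) (a : A) :
    lpG p G E →L[ℂ] lpG p G E :=
  LinearMap.mkContinuous
    { toFun := fun ξ => ⟨fun s => π₀.hom (α s⁻¹ a) (ξ s),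
        (((lp.memℓp ξ).norm.const_mul ‖a‖)).mono fun s =>
          norm_regPi_apply_le α π₀ a s (ξ s)⟩
      map_add' := fun ξ η => by
        ext s
        exact map_add (π₀.hom (α s⁻¹ a)) (ξ s) (η s)
      map_smul' := fun c ξ => by ext s; simp }
    ‖a‖ fun ξ => by
      have h : ‖((‖a‖ : ℂ) • ξ : lpG p G E)‖ = ‖a‖ * ‖ξ‖ := by
        rw [norm_smul]; simp
      rw [← h]
      refine lp.norm_mono (ne_zero_of_fact p) fun s => ?_
      have h2 : ‖((‖a‖ : ℂ) • ξ : lpG p G E) s‖ = ‖a‖ * ‖ξ s‖ := by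
        rw [lp.coeFn_smul, Pi.smul_apply, norm_smul]; simp
      rw [h2]
      exact norm_regPi_apply_le α π₀ a s (ξ s)

theorem regPi_apply (α : IsometricAction G A) (π₀ : ContractiveRep A E) (a : A)
    (ξ : lpG p G E) (s : G) : regPi p α π₀ a ξ s = π₀.hom (α s⁻¹ a) (ξ s) := rfl

theorem norm_regPi_le (α : IsometricAction G A) (π₀ : ContractiveRep A E) (a : A) :
    ‖regPi p α π₀ a‖ ≤ ‖a‖ :=
  LinearMap.mkContinuous_norm_le _ (norm_nonneg _) _

/-- The left translation `λ(s)` on `l^p(G, E)`, `(λ(s) ξ)(t) = ξ(s⁻¹ t)`. -/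
def lam (E : Type u) [NormedAddCommGroup E] [NormedSpace ℂ E] (s : G) :
    lpG p G E →L[ℂ] lpG p G E :=
  LinearMap.mkContinuous
    { toFun := fun ξ => ⟨fun t => ξ (s⁻¹ * t), memlp_comp_equiv p (Equiv.mulLeft s⁻¹) ξ⟩
      map_add' := fun ξ η => by ext t; rfl
      map_smul' := fun c ξ => by ext t; rfl }
    1 fun ξ => by
      rw [one_mul]
      obtain (h0 | rfl | hp') := p.trichotomy
      · exact absurd h0 (ne_zero_of_fact p)
      · exact lp.norm_le_of_forall_le (norm_nonneg _) fun t =>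
          lp.norm_apply_le_norm (by simp) ξ (s⁻¹ * t)
      · refine lp.norm_le_of_tsum_le hp' (norm_nonneg _) ?_
        rw [lp.norm_rpow_eq_tsum hp']
        exact ((Equiv.mulLeft s⁻¹).tsum_eq (fun t => ‖ξ t‖ ^ p.toReal)).le

theorem lam_apply (s : G) (ξ : lpG p G E) (t : G) : lam p E s ξ t = ξ (s⁻¹ * t) := rfl

theorem norm_lam_le (s : G) : ‖lam p E s‖ ≤ 1 :=
  LinearMap.mkContinuous_norm_le _ zero_le_one _

end Regular

/-! ### The twisted convolution algebra -/

/-- The space `C_c(G, A, α)` of finitely supported functions `G → A` (`G` being discrete). The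
parameter `p` and the universe `a` only serve to attach to it below the norm of
`F^p_λ(G, A, α)`, a supremum over representations on spaces `L^p(X, μ)` with `X : Type a` (the
`let` only makes this universe a parameter of the type). -/
@[nolint unusedArguments]
def Cc.{a, b, c} (_p : ℝ≥0∞) {G : Type b} {A : Type c} [Group G] [NonUnitalNormedRing A]
    [NormedSpace ℂ A] (_α : IsometricAction.{b, c} G A) : Type (max b c) :=
  let _ := PUnit.{a + 1}
  G →₀ A

section Algebra

variable {p : ℝ≥0∞} {G : Type v} {A : Type w} [Group G]
  [NonUnitalNormedRing A] [NormedSpace ℂ A] {α : IsometricAction G A}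

instance : AddCommGroup (Cc.{u, v, w} p α) := Finsupp.instAddCommGroup (ι := G) (G := A)

instance : Module ℂ (Cc.{u, v, w} p α) := Finsupp.module G A

namespace Cc

/-- An element of `C_c(G, A, α)`, as a finitely supported function. -/
def toFinsupp (f : Cc.{u, v, w} p α) : G →₀ A := f

/-- The function supported at `s` with value `a` there. -/
def single (s : G) (a : A) : Cc.{u, v, w} p α := Finsupp.single s a

theorem single_add (s : G) (a b : A) :
    (single s (a + b) : Cc.{u, v, w} p α) = single s a + single s b := Finsupp.single_add s a b

theorem single_zero (s : G) : (single s 0 : Cc.{u, v, w} p α) = 0 := Finsupp.single_zero s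

theorem smul_single (c : ℂ) (s : G) (a : A) :
    (c • single s a : Cc.{u, v, w} p α) = single s (c • a) := Finsupp.smul_single c s a

@[elab_as_elim]
theorem induction {P : Cc.{u, v, w} p α → Prop} (f : Cc.{u, v, w} p α) (h0 : P 0)
    (hadd : ∀ f g, P f → P g → P (f + g)) (hs : ∀ s a, P (single s a)) : P f :=
  Finsupp.induction_linear f h0 hadd hs

/-- The additive map on `C_c(G, A, α)` given by `f ↦ ∑_s F_s(f(s))`. -/
def sumHom {N : Type*} [AddCommMonoid N] (F : G → A →+ N) : Cc.{u, v, w} p α →+ N :=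
  Finsupp.liftAddHom F

theorem sumHom_apply {N : Type*} [AddCommMonoid N] (F : G → A →+ N) (f : Cc.{u, v, w} p α) :
    sumHom F f = ∑ s ∈ (toFinsupp f).support, F s (toFinsupp f s) := rfl

theorem sumHom_single {N : Type*} [AddCommMonoid N] (F : G → A →+ N) (s : G) (a : A) :
    sumHom F (single s a : Cc.{u, v, w} p α) = F s a :=
  Finsupp.liftAddHom_apply_single F s a

/-- Twisted convolution as a biadditive map: the bilinear extension of
`(a δ_s) * (b δ_t) = a α_s(b) δ_{st}`. -/
def mulHom : Cc.{u, v, w} p α →+ Cc.{u, v, w} p α →+ Cc.{u, v, w} p α :=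
  sumHom fun s => AddMonoidHom.mk'
    (fun a => sumHom fun t => AddMonoidHom.mk' (fun b => single (s * t) (a * α s b))
      fun b b' => by rw [map_add, mul_add, single_add])
    fun a a' => by
      ext f
      induction f using Cc.induction with
      | h0 => simp
      | hadd f g hf hg => rw [map_add, map_add, hf, hg]
      | hs t b => simp [sumHom_single, add_mul, single_add]

instance : Mul (Cc.{u, v, w} p α) := ⟨fun f g => mulHom f g⟩

theorem mul_def (f g : Cc.{u, v, w} p α) : f * g = mulHom f g := rfl

theorem single_mul_single (s t : G) (a b : A) :
    (single s a * single t b : Cc.{u, v, w} p α) = single (s * t) (a * α s b) := by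
  simp [mul_def, mulHom, sumHom_single]

instance : NonUnitalRing (Cc.{u, v, w} p α) where
  left_distrib f g h := by simp [mul_def]
  right_distrib f g h := by simp [mul_def]
  zero_mul f := by simp [mul_def]
  mul_zero f := by simp [mul_def]
  mul_assoc f g h := by
    induction f using Cc.induction with
    | h0 => simp [mul_def]
    | hadd f f' hf hf' => simp only [mul_def, map_add, AddMonoidHom.add_apply] at *; rw [hf, hf']
    | hs r a =>
      induction g using Cc.induction with
      | h0 => simp [mul_def]
      | hadd f f' hf hf' => simp only [mul_def, map_add, AddMonoidHom.add_apply] at *; rw [hf, hf']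
      | hs s b =>
        induction h using Cc.induction with
        | h0 => simp [mul_def]
        | hadd f f' hf hf' => simp only [mul_def, map_add] at *; rw [hf, hf']
        | hs t c => simp only [single_mul_single, mul_assoc, map_mul, α.map_mul']

/-- The product is twisted convolution, `(f * g)(t) = ∑_s f(s) α_s(g(s⁻¹ t))`. -/
theorem mul_apply (f g : Cc.{u, v, w} p α) (t : G) :
    toFinsupp (f * g) t =
      ∑ s ∈ (toFinsupp f).support, toFinsupp f s * α s (toFinsupp g (s⁻¹ * t)) := by
  classical
  let L : Cc.{u, v, w} p α →+ A := sumHom fun s => AddMonoidHom.mk'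
    (fun a => a * α s (toFinsupp g (s⁻¹ * t))) fun a b => add_mul a b _
  change toFinsupp (f * g) t = L f
  have hadd : ∀ (x y : Cc.{u, v, w} p α) (r : G),
    toFinsupp (x + y) r = toFinsupp x r + toFinsupp y r := fun _ _ _ => rfl
  induction f using Cc.induction with
  | h0 => rw [zero_mul, map_zero]; rfl
  | hadd f f' hf hf' => rw [add_mul, map_add, hadd, hf, hf']
  | hs s a =>
    simp only [L, sumHom_single, AddMonoidHom.mk'_apply]
    clear L
    induction g using Cc.induction with
    | h0 =>
      have h0 : ∀ r, toFinsupp (0 : Cc.{u, v, w} p α) r = 0 := fun _ => rfl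
      rw [mul_zero, h0, h0, map_zero, mul_zero]
    | hadd g g' hg hg' => rw [mul_add, hadd, hadd, hg, hg', map_add, mul_add]
    | hs r b =>
      rw [single_mul_single]
      simp only [toFinsupp, single, Finsupp.single_apply]
      by_cases h : s * r = t
      · subst h; simp
      · have : r ≠ s⁻¹ * t := fun h' => h (by rw [h']; group)
        simp [h, this]

instance [IsScalarTower ℂ A A] : IsScalarTower ℂ (Cc.{u, v, w} p α) (Cc.{u, v, w} p α) where
  smul_assoc c f g := by
    simp only [smul_eq_mul]
    induction f using Cc.induction with
    | h0 => simp
    | hadd f f' hf hf' => rw [smul_add, add_mul, add_mul, smul_add, hf, hf']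
    | hs s a =>
      induction g using Cc.induction with
      | h0 => simp
      | hadd f f' hf hf' => rw [mul_add, mul_add, smul_add, hf, hf']
      | hs t b => simp only [smul_single, single_mul_single, smul_mul_assoc]

instance [SMulCommClass ℂ A A] : SMulCommClass ℂ (Cc.{u, v, w} p α) (Cc.{u, v, w} p α) where
  smul_comm c f g := by
    simp only [smul_eq_mul]
    induction f using Cc.induction with
    | h0 => simp
    | hadd f f' hf hf' => rw [add_mul, add_mul, smul_add, hf, hf']
    | hs s a =>
      induction g using Cc.induction with
      | h0 => simp
      | hadd f f' hf hf' => rw [smul_add, mul_add, mul_add, smul_add, hf, hf']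
      | hs t b => simp only [smul_single, single_mul_single, map_smul, mul_smul_comm]

end Cc

end Algebra

/-! ### Integrated forms and the reduced norm -/

section Integrated

variable {p : ℝ≥0∞} [Fact (1 ≤ p)] {G : Type v} {A : Type w} [Group G]
  [NonUnitalNormedRing A] [NormedSpace ℂ A] {α : IsometricAction G A} {E : Type*}
  [NormedAddCommGroup E] [NormedSpace ℂ E]

theorem regPi_add (π₀ : ContractiveRep A E) (a b : A) :
    regPi p α π₀ (a + b) = regPi p α π₀ a + regPi p α π₀ b := by
  ext ξ s
  simp [regPi_apply]

theorem regPi_smul (π₀ : ContractiveRep A E) (c : ℂ) (a : A) :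
    regPi p α π₀ (c • a) = c • regPi p α π₀ a := by
  ext ξ s
  simp [regPi_apply]

theorem regPi_mul (π₀ : ContractiveRep A E) (a b : A) :
    regPi p α π₀ (a * b) = regPi p α π₀ a * regPi p α π₀ b := by
  ext ξ s
  simp [regPi_apply]

theorem lam_mul (s t : G) : lam p E (s * t) = lam p E s * lam p E t := by
  ext ξ r
  simp [lam_apply, mul_assoc]

/-- Covariance of the regular representation. -/
theorem lam_mul_regPi (π₀ : ContractiveRep A E) (s : G) (a : A) :
    lam p E s * regPi p α π₀ a = regPi p α π₀ (α s a) * lam p E s := by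
  ext ξ t
  simp [lam_apply, regPi_apply, ← α.map_mul']

/-- The integrated form `π ⋊ λ` of the regular covariant representation `(π, λ)` associated with
`π₀`, `(π ⋊ λ)(f) = ∑_s π(f(s)) λ(s)`, on the algebra `C_c(G, A, α)`. -/
def integratedForm (π₀ : ContractiveRep A E) :
    Cc.{u, v, w} p α →ₙₐ[ℂ] (lpG p G E →L[ℂ] lpG p G E) where
  toFun f := ∑ s ∈ (Cc.toFinsupp f).support, regPi p α π₀ (Cc.toFinsupp f s) * lam p E s
  map_zero' := Finset.sum_empty
  map_add' f g := by
    let L : Cc.{u, v, w} p α →+ (lpG p G E →L[ℂ] lpG p G E) := Cc.sumHom fun s =>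
      AddMonoidHom.mk' (fun a => regPi p α π₀ a * lam p E s) fun a b => by rw [regPi_add, add_mul]
    change L (f + g) = L f + L g
    exact L.map_add f g
  map_smul' c f := by
    let L : Cc.{u, v, w} p α →+ (lpG p G E →L[ℂ] lpG p G E) := Cc.sumHom fun s =>
      AddMonoidHom.mk' (fun a => regPi p α π₀ a * lam p E s) fun a b => by rw [regPi_add, add_mul]
    change L (c • f) = c • L f
    induction f using Cc.induction with
    | h0 => simp
    | hadd f g hf hg => rw [smul_add, map_add, map_add, smul_add, hf, hg]
    | hs s a => simp [L, Cc.smul_single, Cc.sumHom_single, regPi_smul]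
  map_mul' f g := by
    let L : Cc.{u, v, w} p α →+ (lpG p G E →L[ℂ] lpG p G E) := Cc.sumHom fun s =>
      AddMonoidHom.mk' (fun a => regPi p α π₀ a * lam p E s) fun a b => by rw [regPi_add, add_mul]
    change L (f * g) = L f * L g
    induction f using Cc.induction with
    | h0 => simp
    | hadd f f' hf hf' => rw [add_mul, map_add, map_add, add_mul, hf, hf']
    | hs s a =>
      induction g using Cc.induction with
      | h0 => simp
      | hadd f f' hf hf' => rw [mul_add, map_add, map_add, mul_add, hf, hf']
      | hs t b =>
        simp only [L, Cc.single_mul_single, Cc.sumHom_single, AddMonoidHom.mk'_apply, regPi_mul,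
          lam_mul]
        rw [mul_assoc, ← mul_assoc (regPi p α π₀ (α s b)), ← lam_mul_regPi]
        simp only [mul_assoc]

theorem integratedForm_apply (π₀ : ContractiveRep A E) (f : Cc.{u, v, w} p α) :
    integratedForm π₀ f =
      ∑ s ∈ (Cc.toFinsupp f).support, regPi p α π₀ (Cc.toFinsupp f s) * lam p E s := rfl

theorem norm_integratedForm_le (π₀ : ContractiveRep A E) (f : Cc.{u, v, w} p α) :
    ‖integratedForm π₀ f‖ ≤ ∑ s ∈ (Cc.toFinsupp f).support, ‖Cc.toFinsupp f s‖ := by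
  rw [integratedForm_apply]
  refine (norm_sum_le _ _).trans (Finset.sum_le_sum fun s _ => ?_)
  calc _ ≤ ‖regPi p α π₀ (Cc.toFinsupp f s)‖ * ‖lam p E s‖ := norm_mul_le _ _
    _ ≤ ‖Cc.toFinsupp f s‖ * 1 :=
      mul_le_mul (norm_regPi_le p α π₀ _) (norm_lam_le p s) (norm_nonneg _) (norm_nonneg _)
    _ = _ := mul_one _

/-- The set of the numbers `‖(π ⋊ λ)(f)‖`, over the regular covariant representations associated
with all nondegenerate contractive representations of `A` on spaces `L^p(X, μ)`, `μ` `σ`-finite. -/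
def normSet (f : Cc.{u, v, w} p α) : Set ℝ :=
  {r | ∃ (X : Type u) (_ : MeasurableSpace X) (μ : Measure X) (_ : SigmaFinite μ)
    (π₀ : ContractiveRep A (Lp ℂ p μ)), π₀.Nondegenerate ∧ ‖integratedForm π₀ f‖ = r}

theorem normSet_bddAbove (f : Cc.{u, v, w} p α) : BddAbove (normSet f) := by
  refine ⟨∑ s ∈ (Cc.toFinsupp f).support, ‖Cc.toFinsupp f s‖, ?_⟩
  rintro _ ⟨X, _, μ, _, π₀, _, rfl⟩
  exact norm_integratedForm_le π₀ f

theorem normSet_nonempty (f : Cc.{u, v, w} p α) : (normSet f).Nonempty := by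
  refine ⟨_, PUnit, ⊤, 0, inferInstance, ContractiveRep.zero A _, ?_, rfl⟩
  have : Subsingleton (Lp ℂ p (0 : @Measure PUnit.{u + 1} ⊤)) :=
    ⟨fun f g => by ext1; simp [Filter.EventuallyEq]⟩
  intro x
  rw [Subsingleton.elim x 0]
  exact subset_closure (Submodule.zero_mem _)

/-- The norm of `F^p_λ(G, A, α)` on `C_c(G, A, α)`, a supremum over a nonempty bounded set. -/
def reducedNorm (f : Cc.{u, v, w} p α) : ℝ := sSup (normSet f)

theorem norm_le_reducedNorm (f : Cc.{u, v, w} p α) {X : Type u} [MeasurableSpace X]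
    (μ : Measure X) [SigmaFinite μ] (π₀ : ContractiveRep A (Lp ℂ p μ)) (h : π₀.Nondegenerate) :
    ‖integratedForm π₀ f‖ ≤ reducedNorm f :=
  le_csSup (normSet_bddAbove f) ⟨X, _, μ, inferInstance, π₀, h, rfl⟩

theorem reducedNorm_le (f : Cc.{u, v, w} p α) {C : ℝ}
    (hC : ∀ (X : Type u) [MeasurableSpace X] (μ : Measure X) [SigmaFinite μ]
      (π₀ : ContractiveRep A (Lp ℂ p μ)), π₀.Nondegenerate → ‖integratedForm π₀ f‖ ≤ C) :
    reducedNorm f ≤ C := by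
  refine csSup_le (normSet_nonempty f) ?_
  rintro _ ⟨X, _, μ, _, π₀, h, rfl⟩
  exact hC X μ π₀ h

theorem reducedNorm_nonneg (f : Cc.{u, v, w} p α) : 0 ≤ reducedNorm f := by
  obtain ⟨_, X, m, μ, hμ, π₀, h, rfl⟩ := normSet_nonempty f
  exact (norm_nonneg _).trans (norm_le_reducedNorm f μ π₀ h)

instance : NonUnitalSeminormedRing (Cc.{u, v, w} p α) where
  __ : SeminormedAddCommGroup (Cc.{u, v, w} p α) := AddGroupSeminorm.toSeminormedAddCommGroup
    { toFun := reducedNorm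
      map_zero' := le_antisymm (reducedNorm_le _ fun X _ μ _ π₀ _ => by simp)
        (reducedNorm_nonneg _)
      add_le' := fun f g => reducedNorm_le _ fun X _ μ _ π₀ h => by
        rw [map_add]
        exact (norm_add_le _ _).trans
          (add_le_add (norm_le_reducedNorm f μ π₀ h) (norm_le_reducedNorm g μ π₀ h))
      neg' := fun f => by
        have : normSet (-f) = normSet f := by
          simp only [normSet, map_neg, norm_neg]
        rw [reducedNorm, this, reducedNorm] }
  __ := (inferInstance : NonUnitalRing (Cc.{u, v, w} p α))
  norm_mul_le f g := reducedNorm_le _ fun X _ μ _ π₀ h => by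
    rw [map_mul]
    exact (norm_mul_le _ _).trans (mul_le_mul (norm_le_reducedNorm f μ π₀ h)
      (norm_le_reducedNorm g μ π₀ h) (norm_nonneg _) (reducedNorm_nonneg _))

theorem norm_def (f : Cc.{u, v, w} p α) : ‖f‖ = reducedNorm f := rfl

instance : NormedSpace ℂ (Cc.{u, v, w} p α) where
  norm_smul_le c f := reducedNorm_le _ fun X _ μ _ π₀ h => by
    rw [map_smul, norm_smul]
    exact mul_le_mul_of_nonneg_left (norm_le_reducedNorm f μ π₀ h) (norm_nonneg _)

end Integrated

/-! ### The reduced crossed product -/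

section Crossed

open UniformSpace

/-- The reduced `L^p` operator crossed product `F^p_λ(G, A, α)`: the completion of `C_c(G, A, α)`
in the reduced norm. -/
abbrev ReducedCrossedProduct.{a, b, c} (p : ℝ≥0∞) [Fact (1 ≤ p)] {G : Type b} {A : Type c}
    [Group G] [NonUnitalNormedRing A] [NormedSpace ℂ A] (α : IsometricAction.{b, c} G A) :
    Type (max b c) :=
  Completion (Cc.{a, b, c} p α)

variable {p : ℝ≥0∞} [Fact (1 ≤ p)] {G : Type v} {A : Type w} [Group G]
  [NonUnitalNormedRing A] [NormedSpace ℂ A] {α : IsometricAction G A}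

/-- The product of `F^p_λ(G, A, α)`: the continuous extension of twisted convolution. -/
instance : Mul (ReducedCrossedProduct.{u, v, w} p α) :=
  ⟨Function.curry <| (Completion.isDenseInducing_coe.prodMap
    Completion.isDenseInducing_coe).extend
      (fun x : Cc.{u, v, w} p α × Cc.{u, v, w} p α =>
        ((x.1 * x.2 : Cc.{u, v, w} p α) : ReducedCrossedProduct.{u, v, w} p α))⟩

theorem coe_mul (f g : Cc.{u, v, w} p α) :
    ((f * g : Cc.{u, v, w} p α) : ReducedCrossedProduct.{u, v, w} p α) = f * g :=
  ((Completion.isDenseInducing_coe.prodMap Completion.isDenseInducing_coe).extend_eq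
    ((Completion.continuous_coe _).comp continuous_mul) (f, g)).symm

instance : ContinuousMul (ReducedCrossedProduct.{u, v, w} p α) where
  continuous_mul := by
    let m := (AddMonoidHom.mul : Cc.{u, v, w} p α →+ Cc.{u, v, w} p α →+ Cc.{u, v, w} p α).compr₂
      Completion.toCompl
    have : Continuous fun x : Cc.{u, v, w} p α × Cc.{u, v, w} p α => m x.1 x.2 :=
      (Completion.continuous_coe _).comp continuous_mul
    have di : IsDenseInducing
        (Completion.toCompl : Cc.{u, v, w} p α → ReducedCrossedProduct.{u, v, w} p α) :=
      Completion.isDenseInducing_coe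
    exact (di.extend_Z_bilin di this :)

instance : NonUnitalNormedRing (ReducedCrossedProduct.{u, v, w} p α) where
  __ := (inferInstance : NormedAddCommGroup (ReducedCrossedProduct.{u, v, w} p α))
  __ := (inferInstance : Mul (ReducedCrossedProduct.{u, v, w} p α))
  zero_mul x := by
    induction x using Completion.induction_on with
    | hp => exact isClosed_eq (by fun_prop) (by fun_prop)
    | ih f => rw [← Completion.coe_zero, ← coe_mul, zero_mul]
  mul_zero x := by
    induction x using Completion.induction_on with
    | hp => exact isClosed_eq (by fun_prop) (by fun_prop)
    | ih f => rw [← Completion.coe_zero, ← coe_mul, mul_zero]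
  mul_assoc x y z :=
    Completion.induction_on₃ x y z (isClosed_eq (by fun_prop) (by fun_prop)) fun f g h => by
      rw [← coe_mul, ← coe_mul, ← coe_mul, ← coe_mul, mul_assoc]
  left_distrib x y z :=
    Completion.induction_on₃ x y z (isClosed_eq (by fun_prop) (by fun_prop)) fun f g h => by
      rw [← Completion.coe_add, ← coe_mul, ← coe_mul, ← coe_mul, ← Completion.coe_add, mul_add]
  right_distrib x y z :=
    Completion.induction_on₃ x y z (isClosed_eq (by fun_prop) (by fun_prop)) fun f g h => by
      rw [← Completion.coe_add, ← coe_mul, ← coe_mul, ← coe_mul, ← Completion.coe_add, add_mul]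
  norm_mul_le x y :=
    Completion.induction_on₂ x y (isClosed_le (by fun_prop) (by fun_prop)) fun f g => by
      rw [← coe_mul, Completion.norm_coe, Completion.norm_coe, Completion.norm_coe]
      exact norm_mul_le f g

instance [IsScalarTower ℂ A A] :
    IsScalarTower ℂ (ReducedCrossedProduct.{u, v, w} p α) (ReducedCrossedProduct.{u, v, w} p α) where
  smul_assoc c x y := by
    simp only [smul_eq_mul]
    exact Completion.induction_on₂ x y
      (isClosed_eq (((continuous_const_smul c).comp continuous_fst).mul continuous_snd)
        ((continuous_const_smul c).comp (continuous_fst.mul continuous_snd))) fun f g => by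
      rw [← Completion.coe_smul, ← coe_mul, ← coe_mul, ← Completion.coe_smul, smul_mul_assoc]

instance [SMulCommClass ℂ A A] :
    SMulCommClass ℂ (ReducedCrossedProduct.{u, v, w} p α) (ReducedCrossedProduct.{u, v, w} p α) where
  smul_comm c x y := by
    simp only [smul_eq_mul]
    exact Completion.induction_on₂ x y
      (isClosed_eq ((continuous_const_smul c).comp (continuous_fst.mul continuous_snd))
        (continuous_fst.mul ((continuous_const_smul c).comp continuous_snd))) fun f g => by
      rw [← Completion.coe_smul, ← coe_mul, ← coe_mul, ← Completion.coe_smul, mul_smul_comm]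

end Crossed

end LpCrossed

end

noncomputable section

namespace LpCrossed

/-! ### Finite sections of the regular representation -/

section FiniteSections

variable {p : ℝ≥0∞} [Fact (1 ≤ p)] {G : Type v} {A : Type w} [Group G]
  [NonUnitalNormedRing A] [NormedSpace ℂ A] {α : IsometricAction G A} {E : Type*}
  [NormedAddCommGroup E] [NormedSpace ℂ E]

/-! Decompose `l^p(G, E)` along the points of `G`. The operator `(π ⋊ λ)(f)` then has the matrix
entries `π(α_{s⁻¹}(f(s t⁻¹)))`, so it is the amplification of an infinite matrix over `A` that does
not depend on the representation. As `p < ∞`, its norm is the supremum of the norms of its finite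
sections (`norm_amplify_sectionMatrix_le`, `norm_integratedForm_le_of_amplify_le`). Everything thus
reduces to a statement about `A` alone: the matrix norms of an isometric representation `π` dominate
those of every contractive representation `σ` (`norm_amplify_le_of_isIsometric`).

A contractive `σ` need not be isometric, but `π ⊕ σ` is, and it contains `σ`. Uniqueness of matrix
norms, applied to `π` and `π ⊕ σ`, gives `‖σ(a)‖ ≤ ‖(π ⊕ σ)(a)‖ = ‖π(a)‖`.

Uniqueness only speaks of separable `L^p` spaces, so both representations are first cut down. By
`exists_separable_subrep`, countably many vectors lie in an invariant subspace that is the `L^p`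
space of a countably generated sub-`σ`-algebra. For `π` the vectors are chosen so that the
restriction stays isometric (`exists_countable_norming`); for `σ` they are the coordinates of the
one vector on which the norm is being tested. -/

/-- The matrix of `f ∈ C_c(G, A, α)` in the regular representation, on the points `e i` of `G`:
its entries are `α_{s⁻¹}(f(s t⁻¹))` for `s = e i` and `t = e j`. -/
def sectionMatrix (f : Cc.{u, v, w} p α) {n : ℕ} (e : Fin n → G) : Matrix (Fin n) (Fin n) A :=
  Matrix.of fun i j => α (e i)⁻¹ (Cc.toFinsupp f (e i * (e j)⁻¹))

theorem integratedForm_apply_apply (π : ContractiveRep A E) (f : Cc.{u, v, w} p α)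
    (ξ : lpG p G E) (s : G) :
    integratedForm π f ξ s =
      ∑ r ∈ (Cc.toFinsupp f).support, π.hom (α s⁻¹ (Cc.toFinsupp f r)) (ξ (r⁻¹ * s)) := by
  rw [integratedForm_apply, sum_apply, lp.coeFn_sum, Finset.sum_apply]
  rfl

/-- If the values of `ξ` that enter into `(π ⋊ λ)(f) ξ` at `e i` are taken on the range of `e`, then
this vector is computed there by the finite section. -/
theorem integratedForm_apply_eq_amplify (π : ContractiveRep A E) (f : Cc.{u, v, w} p α)
    (ξ : lpG p G E) {n : ℕ} {e : Fin n → G} (he : Function.Injective e) (i : Fin n)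
    (hi : ∀ r ∈ (Cc.toFinsupp f).support, ξ (r⁻¹ * e i) ≠ 0 → r⁻¹ * e i ∈ Set.range e) :
    integratedForm π f ξ (e i) =
      amplify p π (sectionMatrix f e) (WithLp.toLp p fun j => ξ (e j)) i := by
  classical
  rw [integratedForm_apply_apply, amplify_apply]
  have hinj : Function.Injective fun j => e i * (e j)⁻¹ := fun j k h => he (by simpa using h)
  let h : G → E := fun r => π.hom (α (e i)⁻¹ (Cc.toFinsupp f r)) (ξ (r⁻¹ * e i))
  have key : ∑ r ∈ (Cc.toFinsupp f).support, h r =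
      ∑ r ∈ Finset.univ.image fun j => e i * (e j)⁻¹, h r := by
    -- The substitution `r = e i * (e j)⁻¹` turns `r⁻¹ * e i` into `e j`. The two index sets differ
    -- only in zero terms: off the second one `ξ` vanishes by `hi`, off the first one `f` does.
    refine Finset.sum_congr_of_eq_on_inter (fun r hr hr' => ?_) (fun r _ hr => ?_)
      fun _ _ _ => rfl
    · by_cases h0 : ξ (r⁻¹ * e i) = 0
      · simp [h, h0]
      · obtain ⟨j, hj⟩ := hi r hr h0
        exact absurd (Finset.mem_image.2 ⟨j, Finset.mem_univ _, by simp [hj]⟩) hr'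
    · have : Cc.toFinsupp f r = 0 := Finsupp.notMem_support_iff.1 hr
      simp [h, this]
  rw [Finset.sum_image hinj.injOn] at key
  exact key.trans (Finset.sum_congr rfl fun j _ => by simp [h, sectionMatrix])

theorem toReal_pos_of_fact (hp : p ≠ ∞) : 0 < p.toReal :=
  ENNReal.toReal_pos (ne_zero_of_fact p) hp

-- Injectivity of `e` means that no coordinate is counted twice, so the left side is a partial sum
-- of the series for `‖ξ‖ ^ p`.
omit [Group G] [NormedSpace ℂ E] in
theorem norm_section_le (hp : p ≠ ∞) (ξ : lpG p G E) {n : ℕ} {e : Fin n → G}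
    (he : Function.Injective e) :
    ‖(WithLp.toLp p fun j => ξ (e j) : PiLp p fun _ : Fin n => E)‖ ≤ ‖ξ‖ := by
  classical
  have hp' := toReal_pos_of_fact hp
  refine (Real.rpow_le_rpow_iff (norm_nonneg _) (norm_nonneg _) hp').1 ?_
  have h := lp.sum_rpow_le_norm_rpow hp' ξ (Finset.univ.image e)
  rw [Finset.sum_image he.injOn] at h
  rw [PiLp.norm_eq_sum hp', ← Real.rpow_mul (by positivity), one_div_mul_cancel hp'.ne',
    Real.rpow_one]
  exact h

/-- Finite sections do not exceed the norm of the whole operator. -/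
theorem norm_amplify_sectionMatrix_le (hp : p ≠ ∞) (π : ContractiveRep A E)
    (f : Cc.{u, v, w} p α) {n : ℕ} {e : Fin n → G} (he : Function.Injective e) :
    ‖amplify p π (sectionMatrix f e)‖ ≤ ‖integratedForm π f‖ := by
  classical
  have hp' := toReal_pos_of_fact hp
  refine ContinuousLinearMap.opNorm_le_bound _ (norm_nonneg _) fun x => ?_
  -- The extension of `x` by zero. It vanishes off the range of `e`, so the section computes every
  -- row `e i` exactly.
  let ξ : lpG p G E := ∑ j, lp.single p (e j) (x j)
  have hξ : ∀ t, ξ t = ∑ j, if e j = t then x j else 0 := fun t => by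
    simp only [ξ, lp.coeFn_sum, Finset.sum_apply, lp.single_apply]
    exact Finset.sum_congr rfl fun j _ => by
      by_cases h : e j = t
      · subst h; simp
      · simp [h]
  have hξe : ∀ j, ξ (e j) = x j := fun j => by
    rw [hξ]; simp [he.eq_iff]
  have hξ0 : ∀ t, ξ t ≠ 0 → t ∈ Set.range e := fun t ht => by
    by_contra h
    exact ht ((hξ t).trans (Finset.sum_eq_zero fun j _ => if_neg fun hj => h ⟨j, hj⟩))
  have hx : (WithLp.toLp p fun j => ξ (e j) : PiLp p fun _ : Fin n => E) = x := by
    ext j; exact hξe j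
  have hnorm : ‖ξ‖ ≤ ‖x‖ := by
    refine lp.norm_le_of_forall_sum_le hp' (norm_nonneg _) fun s => ?_
    rw [PiLp.norm_eq_sum hp', ← Real.rpow_mul (by positivity), one_div_mul_cancel hp'.ne',
      Real.rpow_one]
    calc ∑ t ∈ s, ‖ξ t‖ ^ p.toReal
        ≤ ∑ t ∈ Finset.univ.image e, ‖ξ t‖ ^ p.toReal := by
          have h0 : ∀ t ∈ s, ‖ξ t‖ ^ p.toReal ≠ 0 → t ∈ Set.range e := fun t _ ht =>
            hξ0 t fun h => ht (by simp [h, hp'.ne'])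
          rw [← Finset.sum_filter_of_ne h0]
          refine Finset.sum_le_sum_of_subset_of_nonneg (fun t ht => ?_) fun _ _ _ => by positivity
          obtain ⟨j, rfl⟩ := (Finset.mem_filter.1 ht).2
          exact Finset.mem_image_of_mem _ (Finset.mem_univ _)
      _ = ∑ j, ‖x j‖ ^ p.toReal := by
          rw [Finset.sum_image he.injOn]
          exact Finset.sum_congr rfl fun j _ => by rw [hξe]
  have hT : (WithLp.toLp p fun j => integratedForm π f ξ (e j) : PiLp p fun _ : Fin n => E) =
      amplify p π (sectionMatrix f e) x := by
    ext i
    rw [← hx]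
    exact integratedForm_apply_eq_amplify π f ξ he i fun r _ hr => hξ0 _ hr
  calc ‖amplify p π (sectionMatrix f e) x‖ ≤ ‖integratedForm π f ξ‖ :=
        hT ▸ norm_section_le hp _ he
    _ ≤ ‖integratedForm π f‖ * ‖ξ‖ := ContinuousLinearMap.le_opNorm _ _
    _ ≤ ‖integratedForm π f‖ * ‖x‖ := mul_le_mul_of_nonneg_left hnorm (norm_nonneg _)

/-- The norm of the regular representation is bounded by those of its finite sections. -/
theorem norm_integratedForm_le_of_amplify_le (hp : p ≠ ∞) (π : ContractiveRep A E)
    (f : Cc.{u, v, w} p α) {C : ℝ} (hC : 0 ≤ C)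
    (h : ∀ (n : ℕ) (e : Fin n → G), Function.Injective e →
      ‖amplify p π (sectionMatrix f e)‖ ≤ C) :
    ‖integratedForm π f‖ ≤ C := by
  classical
  have hp' := toReal_pos_of_fact hp
  refine ContinuousLinearMap.opNorm_le_bound _ hC fun ξ => ?_
  refine lp.norm_le_of_forall_sum_le hp' (by positivity) fun S => ?_
  -- Besides the rows `S` to be estimated, `S'` contains every coordinate of `ξ` on which these rows
  -- depend. The section is exact on the rows in `S`; its other rows only enlarge the bound.
  let S' : Finset G :=
    S ∪ S.biUnion fun s => (Cc.toFinsupp f).support.image fun r => r⁻¹ * s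
  let e : Fin S'.card → G := fun i => (S'.equivFin.symm i : G)
  have he : Function.Injective e := Subtype.val_injective.comp S'.equivFin.symm.injective
  have hrange : ∀ t, t ∈ S' → t ∈ Set.range e := fun t ht => ⟨S'.equivFin ⟨t, ht⟩, by simp [e]⟩
  set x : PiLp p fun _ : Fin S'.card => E := WithLp.toLp p fun j => ξ (e j) with hx
  set y := amplify p π (sectionMatrix f e) x
  have hval : ∀ i, e i ∈ S → integratedForm π f ξ (e i) = y i := fun i hi =>
    integratedForm_apply_eq_amplify π f ξ he i fun r hr _ => hrange _ <|
      Finset.mem_union_right _ <| Finset.mem_biUnion.2 ⟨e i, hi, Finset.mem_image_of_mem _ hr⟩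
  have hy : ‖y‖ ≤ C * ‖ξ‖ := (ContinuousLinearMap.le_opNorm _ _).trans
    (mul_le_mul (h _ e he) (norm_section_le hp ξ he) (norm_nonneg _) hC)
  calc ∑ s ∈ S, ‖integratedForm π f ξ s‖ ^ p.toReal
      = ∑ i with e i ∈ S, ‖integratedForm π f ξ (e i)‖ ^ p.toReal := by
        rw [← Finset.sum_image (f := fun s => ‖integratedForm π f ξ s‖ ^ p.toReal) he.injOn]
        congr 1
        ext s
        simp only [Finset.mem_image, Finset.mem_filter, Finset.mem_univ, true_and]
        refine ⟨fun hs => ?_, fun ⟨i, hi, h⟩ => h ▸ hi⟩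
        obtain ⟨i, rfl⟩ := hrange s (Finset.mem_union_left _ hs)
        exact ⟨i, hs, rfl⟩
    _ = ∑ i with e i ∈ S, ‖y i‖ ^ p.toReal :=
        Finset.sum_congr rfl fun i hi => by rw [hval i (Finset.mem_filter.1 hi).2]
    _ ≤ ∑ i, ‖y i‖ ^ p.toReal :=
        Finset.sum_le_sum_of_subset_of_nonneg (Finset.filter_subset _ _) fun _ _ _ => by positivity
    _ = ‖y‖ ^ p.toReal := by
        rw [PiLp.norm_eq_sum hp', ← Real.rpow_mul (by positivity), one_div_mul_cancel hp'.ne',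
          Real.rpow_one]
    _ ≤ (C * ‖ξ‖) ^ p.toReal := Real.rpow_le_rpow (norm_nonneg _) hy hp'.le

end FiniteSections

/-! ### Intertwining isometries -/

section Intertwine

variable {p : ℝ≥0∞} [Fact (1 ≤ p)] {A : Type w} [NonUnitalNormedRing A] [NormedSpace ℂ A]
  {E F : Type*} [NormedAddCommGroup E] [NormedSpace ℂ E] [NormedAddCommGroup F] [NormedSpace ℂ F]

/-- The diagonal amplification of a linear isometry preserves the norm. -/
theorem norm_toLp_map (hp : p ≠ ∞) (V : E →ₗᵢ[ℂ] F) {n : ℕ} (x : PiLp p fun _ : Fin n => E) :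
    ‖(WithLp.toLp p fun i => V (x i) : PiLp p fun _ : Fin n => F)‖ = ‖x‖ := by
  have hp' := toReal_pos_of_fact hp
  simp [PiLp.norm_eq_sum hp']

theorem amplify_toLp_map (V : E →ₗᵢ[ℂ] F) {π : ContractiveRep A E} {σ : ContractiveRep A F}
    (hV : ∀ a x, V (π.hom a x) = σ.hom a (V x)) {n : ℕ} (a : Matrix (Fin n) (Fin n) A)
    (x : PiLp p fun _ : Fin n => E) :
    amplify p σ a (WithLp.toLp p fun i => V (x i)) =
      WithLp.toLp p fun i => V (amplify p π a x i) := by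
  ext i
  simp [amplify_apply, map_sum, hV]

/-- A subrepresentation has smaller matrix norms. -/
theorem norm_amplify_le_of_intertwine (hp : p ≠ ∞) (V : E →ₗᵢ[ℂ] F) {π : ContractiveRep A E}
    {σ : ContractiveRep A F} (hV : ∀ a x, V (π.hom a x) = σ.hom a (V x)) {n : ℕ}
    (a : Matrix (Fin n) (Fin n) A) : ‖amplify p π a‖ ≤ ‖amplify p σ a‖ := by
  refine ContinuousLinearMap.opNorm_le_bound _ (norm_nonneg _) fun x => ?_
  rw [← norm_toLp_map hp V, ← amplify_toLp_map V hV, ← norm_toLp_map hp V x]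
  exact ContinuousLinearMap.le_opNorm _ _

end Intertwine

/-! ### Subrepresentations and direct sums -/

section Constructions

variable {A : Type w} [NonUnitalNormedRing A] [NormedSpace ℂ A]
  {E F H : Type*} [NormedAddCommGroup E] [NormedSpace ℂ E] [NormedAddCommGroup F] [NormedSpace ℂ F]
  [NormedAddCommGroup H] [NormedSpace ℂ H]

theorem ContractiveRep.norm_apply_le (π : ContractiveRep A E) (a : A) (x : E) :
    ‖π.hom a x‖ ≤ ‖a‖ * ‖x‖ :=
  (ContinuousLinearMap.le_opNorm _ _).trans
    (mul_le_mul_of_nonneg_right (π.norm_le a) (norm_nonneg _))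

theorem ContractiveRep.continuous_hom (π : ContractiveRep A E) : Continuous π.hom :=
  AddMonoidHomClass.continuous_of_bound π.hom 1 fun a => by simpa using π.norm_le a

/-- A contractive representation, from a family of linear maps. -/
def ContractiveRep.ofLinear (T : A → E →ₗ[ℂ] E) (hT : ∀ a x, ‖T a x‖ ≤ ‖a‖ * ‖x‖)
    (hadd : ∀ a b x, T (a + b) x = T a x + T b x) (hsmul : ∀ (c : ℂ) a x, T (c • a) x = c • T a x)
    (hmul : ∀ a b x, T (a * b) x = T a (T b x)) : ContractiveRep A E where
  hom :=
    { toFun := fun a => (T a).mkContinuous ‖a‖ (hT a)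
      map_smul' := fun c a => by ext x; exact hsmul c a x
      map_zero' := by ext x; simpa using hsmul 0 0 x
      map_add' := fun a b => by ext x; exact hadd a b x
      map_mul' := fun a b => by ext x; exact hmul a b x }
  norm_le a := LinearMap.mkContinuous_norm_le (T a) (norm_nonneg a) (hT a)

theorem ContractiveRep.ofLinear_hom_apply (T : A → E →ₗ[ℂ] E) (hT : ∀ a x, ‖T a x‖ ≤ ‖a‖ * ‖x‖)
    (hadd : ∀ a b x, T (a + b) x = T a x + T b x) (hsmul : ∀ (c : ℂ) a x, T (c • a) x = c • T a x)
    (hmul : ∀ a b x, T (a * b) x = T a (T b x)) (a : A) (x : E) :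
    (ContractiveRep.ofLinear T hT hadd hsmul hmul).hom a x = T a x := rfl

/-- The restriction of a representation to an invariant subspace, the image of an isometry. -/
theorem exists_subrep (π : ContractiveRep A E) (V : F →ₗᵢ[ℂ] E)
    (h : ∀ a x, π.hom a (V x) ∈ LinearMap.range V.toLinearMap) :
    ∃ σ : ContractiveRep A F, ∀ a x, V (σ.hom a x) = π.hom a (V x) := by
  -- This is `V⁻¹ π(a) V`, which makes sense by invariance of the range. The bound and the algebraic
  -- laws are verified after applying `V`.
  let T : A → F →ₗ[ℂ] F := fun a => (V.equivRange.symm : _ →ₗ[ℂ] F) ∘ₗ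
    LinearMap.codRestrict (LinearMap.range V.toLinearMap)
      ((π.hom a : E →ₗ[ℂ] E) ∘ₗ V.toLinearMap) (h a)
  have hT : ∀ a x, V (T a x) = π.hom a (V x) := fun a x =>
    congrArg Subtype.val (V.equivRange.apply_symm_apply ⟨π.hom a (V x), h a x⟩)
  refine ⟨ContractiveRep.ofLinear T (fun a x => ?_) (fun a b x => ?_) (fun c a x => ?_)
    (fun a b x => ?_), fun a x => ?_⟩
  · rw [← V.norm_map, hT, ← V.norm_map x]
    exact π.norm_apply_le a _
  · exact V.injective (by simp [hT])
  · exact V.injective (by simp [hT])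
  · exact V.injective (by simp [hT])
  · rw [ContractiveRep.ofLinear_hom_apply, hT]

/-- The `ℓ^p` direct sum of two representations, on a space `H` isomorphic to `E ⊕_p F`. -/
theorem exists_directSum {r : ℝ} (hr : 0 < r) (D : H ≃ₗ[ℂ] E × F)
    (hD : ∀ z, ‖z‖ ^ r = ‖(D z).1‖ ^ r + ‖(D z).2‖ ^ r) (π : ContractiveRep A E)
    (σ : ContractiveRep A F) :
    ∃ τ : ContractiveRep A H, ∀ a z, D (τ.hom a z) = (π.hom a (D z).1, σ.hom a (D z).2) := by
  let T : A → H →ₗ[ℂ] H := fun a => (D.symm : E × F →ₗ[ℂ] H) ∘ₗ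
    (LinearMap.prodMap (π.hom a : E →ₗ[ℂ] E) (σ.hom a : F →ₗ[ℂ] F)) ∘ₗ (D : H →ₗ[ℂ] E × F)
  have hT : ∀ a z, D (T a z) = (π.hom a (D z).1, σ.hom a (D z).2) := fun a z =>
    D.apply_symm_apply _
  refine ⟨ContractiveRep.ofLinear T (fun a x => ?_) (fun a b x => ?_) (fun c a x => ?_)
    (fun a b x => ?_), fun a x => ?_⟩
  -- After passing to `r`-th powers, `hD` splits both sides, and the bound is checked in each
  -- summand.
  · refine (Real.rpow_le_rpow_iff (norm_nonneg _) (by positivity) hr).1 ?_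
    rw [hD, hT, Real.mul_rpow (norm_nonneg _) (norm_nonneg _), hD x, mul_add,
      ← Real.mul_rpow (norm_nonneg _) (norm_nonneg _),
      ← Real.mul_rpow (norm_nonneg _) (norm_nonneg _)]
    exact add_le_add
      (Real.rpow_le_rpow (norm_nonneg _) (π.norm_apply_le _ _) hr.le)
      (Real.rpow_le_rpow (norm_nonneg _) (σ.norm_apply_le _ _) hr.le)
  · exact D.injective (by simp [hT])
  · exact D.injective (by simp [hT])
  · exact D.injective (by simp [hT])
  · rw [ContractiveRep.ofLinear_hom_apply, hT]

/-- The inclusion of the first summand. -/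
def directSumInl {r : ℝ} (hr : 0 < r) (D : H ≃ₗ[ℂ] E × F)
    (hD : ∀ z, ‖z‖ ^ r = ‖(D z).1‖ ^ r + ‖(D z).2‖ ^ r) : E →ₗᵢ[ℂ] H where
  toLinearMap := (D.symm : E × F →ₗ[ℂ] H) ∘ₗ LinearMap.inl ℂ E F
  norm_map' x := (Real.rpow_left_inj (norm_nonneg _) (norm_nonneg _) hr.ne').1 <| by
    simp [hD, Real.zero_rpow hr.ne']

/-- The inclusion of the second summand. -/
def directSumInr {r : ℝ} (hr : 0 < r) (D : H ≃ₗ[ℂ] E × F)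
    (hD : ∀ z, ‖z‖ ^ r = ‖(D z).1‖ ^ r + ‖(D z).2‖ ^ r) : F →ₗᵢ[ℂ] H where
  toLinearMap := (D.symm : E × F →ₗ[ℂ] H) ∘ₗ LinearMap.inr ℂ E F
  norm_map' x := (Real.rpow_left_inj (norm_nonneg _) (norm_nonneg _) hr.ne').1 <| by
    simp [hD, Real.zero_rpow hr.ne']

/-- `D` is only an algebraic isomorphism. Continuity comes from the two isometric inclusions, whose
sum maps the separable space `E × F` continuously onto `H`. -/
theorem separableSpace_of_directSum {r : ℝ} (hr : 0 < r) (D : H ≃ₗ[ℂ] E × F)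
    (hD : ∀ z, ‖z‖ ^ r = ‖(D z).1‖ ^ r + ‖(D z).2‖ ^ r) [TopologicalSpace.SeparableSpace E]
    [TopologicalSpace.SeparableSpace F] : TopologicalSpace.SeparableSpace H := by
  let f : E × F → H := fun z => directSumInl hr D hD z.1 + directSumInr hr D hD z.2
  have hf : Continuous f := ((directSumInl hr D hD).continuous.comp continuous_fst).add
    ((directSumInr hr D hD).continuous.comp continuous_snd)
  refine Function.Surjective.denseRange (f := f) (fun z => ⟨D z, D.injective ?_⟩)
    |>.separableSpace hf
  simp [f, directSumInl, directSumInr]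

/-- An isometric representation and a contractive one are both contained in an isometric
representation on their `ℓ^p` direct sum. -/
theorem exists_isometric_directSum {r : ℝ} (hr : 0 < r) (D : H ≃ₗ[ℂ] E × F)
    (hD : ∀ z, ‖z‖ ^ r = ‖(D z).1‖ ^ r + ‖(D z).2‖ ^ r) (π : ContractiveRep A E)
    (hπ : π.IsIsometric) (σ : ContractiveRep A F) :
    ∃ τ : ContractiveRep A H, τ.IsIsometric ∧
      ∀ a y, directSumInr hr D hD (σ.hom a y) = τ.hom a (directSumInr hr D hD y) := by
  obtain ⟨τ, hτ⟩ := exists_directSum hr D hD π σ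
  refine ⟨τ, fun a => (τ.norm_le a).antisymm ?_, fun a y => D.injective ?_⟩
  · rw [← hπ a]
    -- The first summand already gives the lower bound: there `τ` acts as the isometric `π`.
    refine ContinuousLinearMap.opNorm_le_bound _ (norm_nonneg _) fun y => ?_
    have h : directSumInl hr D hD (π.hom a y) = τ.hom a (directSumInl hr D hD y) :=
      D.injective (by simp [hτ, directSumInl])
    rw [← (directSumInl hr D hD).norm_map, h, ← (directSumInl hr D hD).norm_map y]
    exact ContinuousLinearMap.le_opNorm _ _
  · simp [hτ, directSumInr]

end Constructions

/-! ### `L^p` spaces of disjoint unions -/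

section Sum

variable {X Y : Type*} [MeasurableSpace X] [MeasurableSpace Y]

theorem measurableEmbedding_inl : MeasurableEmbedding (Sum.inl : X → X ⊕ Y) :=
  ⟨Sum.inl_injective, measurable_inl, fun _ hs => hs.inl_image⟩

theorem measurableEmbedding_inr : MeasurableEmbedding (Sum.inr : Y → X ⊕ Y) :=
  ⟨Sum.inr_injective, measurable_inr, fun _ hs => hs.inr_image⟩

/-- The measure on `X ⊕ Y` that restricts to `μ` on `X` and to `ν` on `Y`. -/
def sumMeasure (μ : Measure X) (ν : Measure Y) : Measure (X ⊕ Y) :=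
  μ.map Sum.inl + ν.map Sum.inr

variable {μ : Measure X} {ν : Measure Y}

instance [SigmaFinite μ] [SigmaFinite ν] : SigmaFinite (sumMeasure μ ν) := by
  have := measurableEmbedding_inl.sigmaFinite_map (μ := μ) (f := (Sum.inl : X → X ⊕ Y))
  have := measurableEmbedding_inr.sigmaFinite_map (μ := ν) (f := (Sum.inr : Y → X ⊕ Y))
  exact inferInstanceAs (SigmaFinite (μ.map Sum.inl + ν.map Sum.inr))

theorem ae_sumMeasure_iff {P : X ⊕ Y → Prop} :
    (∀ᵐ z ∂sumMeasure μ ν, P z) ↔ (∀ᵐ x ∂μ, P (Sum.inl x)) ∧ ∀ᵐ y ∂ν, P (Sum.inr y) := by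
  rw [sumMeasure, ae_add_measure_iff, measurableEmbedding_inl.ae_map_iff,
    measurableEmbedding_inr.ae_map_iff]

/-- No measurability of `f` is needed, because `Sum.inl` and `Sum.inr` are measurable embeddings. -/
theorem lintegral_sumMeasure (f : X ⊕ Y → ℝ≥0∞) :
    ∫⁻ z, f z ∂sumMeasure μ ν = ∫⁻ x, f (Sum.inl x) ∂μ + ∫⁻ y, f (Sum.inr y) ∂ν := by
  rw [sumMeasure, lintegral_add_measure, measurableEmbedding_inl.lintegral_map,
    measurableEmbedding_inr.lintegral_map]

variable {p : ℝ≥0∞}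

/-- The `p`-th power of the seminorm is an integral, hence additive over the two pieces. -/
theorem eLpNorm_rpow_sumMeasure (h0 : p ≠ 0) (hp : p ≠ ∞) (f : X ⊕ Y → ℂ) :
    eLpNorm f p (sumMeasure μ ν) ^ p.toReal =
      eLpNorm (f ∘ Sum.inl) p μ ^ p.toReal + eLpNorm (f ∘ Sum.inr) p ν ^ p.toReal := by
  have hp' := ENNReal.toReal_pos h0 hp
  simp only [eLpNorm_eq_lintegral_rpow_enorm_toReal h0 hp, ← ENNReal.rpow_mul,
    one_div_mul_cancel hp'.ne', ENNReal.rpow_one, lintegral_sumMeasure, Function.comp]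

theorem memLp_sumMeasure_iff (h0 : p ≠ 0) (hp : p ≠ ∞) {f : X ⊕ Y → ℂ} :
    MemLp f p (sumMeasure μ ν) ↔ MemLp (f ∘ Sum.inl) p μ ∧ MemLp (f ∘ Sum.inr) p ν := by
  have hp' := ENNReal.toReal_pos h0 hp
  have h1 : AEStronglyMeasurable f (sumMeasure μ ν) ↔
      AEStronglyMeasurable (f ∘ Sum.inl) μ ∧ AEStronglyMeasurable (f ∘ Sum.inr) ν := by
    rw [sumMeasure, aestronglyMeasurable_add_measure_iff,
      measurableEmbedding_inl.aestronglyMeasurable_map_iff,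
      measurableEmbedding_inr.aestronglyMeasurable_map_iff]
  have h2 : eLpNorm f p (sumMeasure μ ν) < ∞ ↔
      eLpNorm (f ∘ Sum.inl) p μ < ∞ ∧ eLpNorm (f ∘ Sum.inr) p ν < ∞ := by
    rw [← ENNReal.rpow_lt_top_iff_of_pos hp', eLpNorm_rpow_sumMeasure h0 hp, ENNReal.add_lt_top,
      ENNReal.rpow_lt_top_iff_of_pos hp', ENNReal.rpow_lt_top_iff_of_pos hp']
  rw [MemLp, h1, h2, MemLp, MemLp]
  tauto

variable (μ ν p) in
/-- The isomorphism of `L^p(X ⊕ Y)` with the direct sum of `L^p(X)` and `L^p(Y)`. -/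
def lpSumEquiv (h0 : p ≠ 0) (hp : p ≠ ∞) :
    Lp ℂ p (sumMeasure μ ν) ≃ₗ[ℂ] Lp ℂ p μ × Lp ℂ p ν where
  toFun f := (((memLp_sumMeasure_iff h0 hp).1 (Lp.memLp f)).1.toLp _,
    ((memLp_sumMeasure_iff h0 hp).1 (Lp.memLp f)).2.toLp _)
  map_add' f g := by
    have h := ae_sumMeasure_iff.1 (Lp.coeFn_add f g)
    have hfg := (memLp_sumMeasure_iff h0 hp).1 (Lp.memLp (f + g))
    have hf := (memLp_sumMeasure_iff h0 hp).1 (Lp.memLp f)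
    have hg := (memLp_sumMeasure_iff h0 hp).1 (Lp.memLp g)
    exact Prod.ext (MemLp.toLp_congr hfg.1 (hf.1.add hg.1) h.1)
      (MemLp.toLp_congr hfg.2 (hf.2.add hg.2) h.2)
  map_smul' c f := by
    have h := ae_sumMeasure_iff.1 (Lp.coeFn_smul c f)
    have hcf := (memLp_sumMeasure_iff h0 hp).1 (Lp.memLp (c • f))
    have hf := (memLp_sumMeasure_iff h0 hp).1 (Lp.memLp f)
    exact Prod.ext (MemLp.toLp_congr hcf.1 (hf.1.const_smul c) h.1)
      (MemLp.toLp_congr hcf.2 (hf.2.const_smul c) h.2)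
  invFun z := ((memLp_sumMeasure_iff (f := Sum.elim z.1 z.2) h0 hp).2
    ⟨Lp.memLp z.1, Lp.memLp z.2⟩).toLp _
  left_inv f := by
    ext1
    refine (MemLp.coeFn_toLp _).trans (ae_sumMeasure_iff.2 ⟨?_, ?_⟩)
    · exact MemLp.coeFn_toLp ((memLp_sumMeasure_iff h0 hp).1 (Lp.memLp f)).1
    · exact MemLp.coeFn_toLp ((memLp_sumMeasure_iff h0 hp).1 (Lp.memLp f)).2
  right_inv z := by
    have h := ae_sumMeasure_iff.1 (MemLp.coeFn_toLp
      ((memLp_sumMeasure_iff (μ := μ) (ν := ν) (f := Sum.elim z.1 z.2) h0 hp).2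
        ⟨Lp.memLp z.1, Lp.memLp z.2⟩))
    have hz := (memLp_sumMeasure_iff h0 hp).1 (Lp.memLp
      (((memLp_sumMeasure_iff (μ := μ) (ν := ν) (f := Sum.elim z.1 z.2) h0 hp).2
        ⟨Lp.memLp z.1, Lp.memLp z.2⟩).toLp _))
    exact Prod.ext (Lp.ext (hz.1.coeFn_toLp.trans h.1)) (Lp.ext (hz.2.coeFn_toLp.trans h.2))

/-- This makes `L^p(X ⊕ Y)` an `ℓ^p` direct sum: it is the hypothesis `hD` of the direct sum
construction, with `r = p.toReal`. -/
theorem norm_rpow_lpSumEquiv (h0 : p ≠ 0) (hp : p ≠ ∞) (f : Lp ℂ p (sumMeasure μ ν)) :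
    ‖f‖ ^ p.toReal = ‖(lpSumEquiv μ ν p h0 hp f).1‖ ^ p.toReal +
      ‖(lpSumEquiv μ ν p h0 hp f).2‖ ^ p.toReal := by
  have h := (memLp_sumMeasure_iff h0 hp).1 (Lp.memLp f)
  have e := congrArg ENNReal.toReal (eLpNorm_rpow_sumMeasure (μ := μ) (ν := ν) h0 hp f)
  rw [ENNReal.toReal_add (by simp [h.1.2.ne]) (by simp [h.2.2.ne])] at e
  simp only [← ENNReal.toReal_rpow] at e
  rw [Lp.norm_def, e]
  change _ = ‖h.1.toLp _‖ ^ _ + ‖h.2.toLp _‖ ^ _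
  rw [Lp.norm_toLp, Lp.norm_toLp]

end Sum

/-! ### Separable subrepresentations on `L^p` spaces -/

section Separable

/-- A countable family of sets is contained in a countable algebra of sets that is closed under a
given countably-valued operation. -/
theorem exists_countable_isSetAlgebra {X : Type*} [MeasurableSpace X] {𝒞 : Set (Set X)}
    (h𝒞 : 𝒞.Countable) (hm : ∀ s ∈ 𝒞, MeasurableSet s) (F : Set X → Set (Set X))
    (hF : ∀ s, (F s).Countable) (hFm : ∀ s, ∀ t ∈ F s, MeasurableSet t) :
    ∃ 𝒜 : Set (Set X), 𝒜.Countable ∧ IsSetAlgebra 𝒜 ∧ (∀ s ∈ 𝒜, MeasurableSet s) ∧ 𝒞 ⊆ 𝒜 ∧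
      ∀ s ∈ 𝒜, F s ⊆ 𝒜 := by
  -- Closing up to an algebra creates new sets to which `F` must be applied, and these destroy the
  -- algebra again. Both closures hold for the union of the iterates.
  let step : Set (Set X) → Set (Set X) := fun 𝒟 => generateSetAlgebra (𝒟 ∪ ⋃ s ∈ 𝒟, F s)
  let 𝒟 : ℕ → Set (Set X) := fun k => step^[k] 𝒞
  have hsucc : ∀ k, 𝒟 (k + 1) = step (𝒟 k) := fun k => Function.iterate_succ_apply' _ _ _
  have hle : ∀ k, 𝒟 k ∪ (⋃ s ∈ 𝒟 k, F s) ⊆ 𝒟 (k + 1) := fun k => by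
    rw [hsucc]; exact self_subset_generateSetAlgebra
  have hmono : Monotone 𝒟 := monotone_nat_of_le_succ fun k => Set.subset_union_left.trans (hle k)
  have halg : ∀ k, IsSetAlgebra (𝒟 (k + 1)) := fun k => by
    rw [hsucc]; exact isSetAlgebra_generateSetAlgebra
  have hcount : ∀ k, (𝒟 k).Countable := fun k => by
    induction k with
    | zero => exact h𝒞
    | succ k ih =>
      rw [hsucc]
      exact countable_generateSetAlgebra (ih.union (ih.biUnion fun s _ => hF s))
  have hmeas : ∀ k, 𝒟 k ⊆ {s | MeasurableSet s} := fun k => by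
    induction k with
    | zero => exact hm
    | succ k ih =>
      rw [hsucc]
      have hms : IsSetAlgebra {s : Set X | MeasurableSet s} :=
        ⟨MeasurableSet.empty, fun _ h => MeasurableSet.compl h,
          fun _ _ h h' => MeasurableSet.union h h'⟩
      exact hms.generateSetAlgebra_subset
        (Set.union_subset ih (Set.iUnion₂_subset fun s _ => hFm s))
  refine ⟨⋃ k, 𝒟 k, Set.countable_iUnion hcount, ⟨?_, ?_, ?_⟩, ?_, ?_, ?_⟩
  -- Stage `0` is `𝒞`, which need not be an algebra; hence the index `1` here and the successors
  -- below.
  · exact Set.mem_iUnion.2 ⟨1, (halg 0).empty_mem⟩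
  · intro s hs
    obtain ⟨k, hk⟩ := Set.mem_iUnion.1 hs
    exact Set.mem_iUnion.2 ⟨k + 1, (halg k).compl_mem (hmono k.le_succ hk)⟩
  · intro s t hs ht
    obtain ⟨k, hk⟩ := Set.mem_iUnion.1 hs
    obtain ⟨l, hl⟩ := Set.mem_iUnion.1 ht
    exact Set.mem_iUnion.2 ⟨max k l + 1, (halg _).union_mem
      (hmono (by omega) hk) (hmono (by omega) hl)⟩
  · intro s hs
    obtain ⟨k, hk⟩ := Set.mem_iUnion.1 hs
    exact hmeas k hk
  · exact Set.subset_iUnion 𝒟 0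
  · intro s hs t ht
    obtain ⟨k, hk⟩ := Set.mem_iUnion.1 hs
    exact Set.mem_iUnion.2 ⟨k + 1, hle k (Or.inr (Set.mem_biUnion hk ht))⟩

variable {p : ℝ≥0∞} [Fact (1 ≤ p)] {X : Type u}

/-- The preimages of a countable basis of `ℂ` under `f`. -/
def basisPreimages (f : X → ℂ) : Set (Set X) :=
  (f ⁻¹' ·) '' TopologicalSpace.countableBasis ℂ

theorem countable_basisPreimages (f : X → ℂ) : (basisPreimages f).Countable :=
  (TopologicalSpace.countable_countableBasis ℂ).image _

theorem measurableSet_of_mem_basisPreimages [MeasurableSpace X] {f : X → ℂ} (hf : Measurable f) {s : Set X}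
    (hs : s ∈ basisPreimages f) : MeasurableSet s := by
  obtain ⟨U, hU, rfl⟩ := hs
  exact hf (TopologicalSpace.isOpen_of_mem_countableBasis hU).measurableSet

/-- A countable basis generates the Borel sets of `ℂ`, so countably many sets suffice to make a
function measurable. -/
theorem measurable_generateFrom_of_basisPreimages {f : X → ℂ} {𝒜 : Set (Set X)}
    (h : basisPreimages f ⊆ 𝒜) : Measurable[MeasurableSpace.generateFrom 𝒜] f := by
  rw [BorelSpace.measurable_eq (α := ℂ),
    (TopologicalSpace.isBasis_countableBasis ℂ).borel_eq_generateFrom]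
  exact @measurable_generateFrom _ _ (MeasurableSpace.generateFrom 𝒜) _ _ fun U hU =>
    MeasurableSpace.measurableSet_generateFrom (h ⟨U, hU, rfl⟩)

variable (p) in
open Classical in
/-- The indicator of `s` in `L^p`, or zero if it does not belong to `L^p`. -/
def indicatorLp {m : MeasurableSpace X} (μ : Measure X) (s : Set X) : Lp ℂ p μ :=
  if h : MeasurableSet s ∧ μ s ≠ ∞ then indicatorConstLp p h.1 h.2 1 else 0

-- The chosen representative of `f` is itself measurable for `m`, not merely up to a null set.
omit [Fact (1 ≤ p)] in
theorem mem_lpMeas_of_basisPreimages {m mX : MeasurableSpace X} {μ : Measure X}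
    {𝒜 : Set (Set X)} (hgen : m = MeasurableSpace.generateFrom 𝒜) {f : Lp ℂ p μ}
    (h : basisPreimages f ⊆ 𝒜) : f ∈ lpMeas ℂ ℂ m p μ := by
  subst hgen
  exact mem_lpMeas_iff_aestronglyMeasurable.2 (StronglyMeasurable.aestronglyMeasurable
    (Measurable.stronglyMeasurable (measurable_generateFrom_of_basisPreimages h)))

variable (p) in
/-- The isometric inclusion of the `L^p` space of a sub-`σ`-algebra. -/
def lpTrimIncl {m mX : MeasurableSpace X} (μ : Measure X) (hm : m ≤ mX) :
    Lp ℂ p (μ.trim hm) →ₗᵢ[ℂ] Lp ℂ p μ :=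
  (lpMeas ℂ ℂ m p μ).subtypeₗᵢ.comp (lpMeasToLpTrimLie ℂ ℂ p μ hm).symm.toLinearIsometry

theorem range_lpTrimIncl {m mX : MeasurableSpace X} (μ : Measure X) (hm : m ≤ mX) :
    LinearMap.range (lpTrimIncl p μ hm).toLinearMap = lpMeas ℂ ℂ m p μ := by
  ext f
  constructor
  · rintro ⟨g, rfl⟩
    exact ((lpMeasToLpTrimLie ℂ ℂ p μ hm).symm g).2
  · intro hf
    exact ⟨lpMeasToLpTrimLie ℂ ℂ p μ hm ⟨f, hf⟩, by simp [lpTrimIncl]⟩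

/-- Trimming keeps the measure of `s`, so the default value zero occurs on both sides or on neither.
-/
theorem lpTrimIncl_indicatorLp {m mX : MeasurableSpace X} {μ : Measure X} (hm : m ≤ mX)
    {s : Set X} (hs : MeasurableSet[m] s) :
    lpTrimIncl p μ hm (indicatorLp p (μ.trim hm) s) = indicatorLp p μ s := by
  by_cases h : μ s = ∞
  · rw [indicatorLp, indicatorLp, dif_neg (by rw [trim_measurableSet_eq hm hs]; tauto),
      dif_neg (by tauto), map_zero]
  · rw [indicatorLp, indicatorLp, dif_pos ⟨hs, by rwa [trim_measurableSet_eq hm hs]⟩,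
      dif_pos ⟨hm _ hs, h⟩]
    exact lpMeasToLpTrimLie_symm_indicator (hm := hm) hs _ 1

/-- The indicators of the sets in a generating algebra span a dense subspace of `L^p`. -/
theorem mem_of_forall_indicatorLp_mem {m : MeasurableSpace X} {ν : Measure X} (hp : p ≠ ∞)
    {𝒜 : Set (Set X)} (halg : IsSetAlgebra 𝒜) (hgen : m = MeasurableSpace.generateFrom 𝒜)
    (S : ν.FiniteSpanningSetsIn 𝒜) {K : Submodule ℂ (Lp ℂ p ν)}
    (hK : IsClosed (K : Set (Lp ℂ p ν))) (h : ∀ s ∈ 𝒜, indicatorLp p ν s ∈ K) (g : Lp ℂ p ν) :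
    g ∈ K := by
  have : Fact (p ≠ ∞) := ⟨hp⟩
  -- Sets of finite measure are approximated in measure by sets of the algebra, hence their
  -- indicators in `L^p`. It then remains to rescale the constant `1`.
  have hdense := Measure.MeasureDense.of_generateFrom_isSetAlgebra_sigmaFinite halg S hgen
  refine Lp.induction hp (motive := fun g => g ∈ K) (fun c s hs hμs => ?_)
    (fun f g hf hg _ h1 h2 => K.add_mem h1 h2) hK g
  have hc : indicatorConstLp p hs hμs.ne c = c • indicatorConstLp p hs hμs.ne (1 : ℂ) := by
    simp only [indicatorConstLp, ← MemLp.toLp_const_smul]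
    refine MemLp.toLp_congr _ _ (Filter.Eventually.of_forall fun x => ?_)
    by_cases hx : x ∈ s <;> simp [hx]
  rw [Lp.simpleFunc.coe_indicatorConst, hc]
  refine K.smul_mem c (closure_minimal ?_ hK
    (hdense.indicatorConstLp_subset_closure p 1 ⟨s, hs, hμs.ne, rfl⟩))
  rintro _ ⟨t, ht, hμt, rfl⟩
  have := h t ht
  rwa [indicatorLp, dif_pos ⟨hdense.measurable t ht, hμt⟩] at this

theorem separableSpace_lp_of_generateFrom {m : MeasurableSpace X} {ν : Measure X} (hp : p ≠ ∞)
    (hσ : SigmaFinite ν) {𝒜 : Set (Set X)} (hcount : 𝒜.Countable)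
    (hgen : m = MeasurableSpace.generateFrom 𝒜) :
    TopologicalSpace.SeparableSpace (Lp ℂ p ν) := by
  have : Fact (p ≠ ∞) := ⟨hp⟩
  have : MeasurableSpace.CountablyGenerated X := ⟨𝒜, hcount, hgen⟩
  infer_instance

/-- A representation of a separable algebra on an `L^p` space restricts to the `L^p` space of some
countably generated sub-`σ`-algebra, which can be taken to contain countably many given vectors. -/
theorem exists_separable_subrep [mX : MeasurableSpace X] {μ : Measure X} {A : Type w} [NonUnitalNormedRing A] [NormedSpace ℂ A]
    [TopologicalSpace.SeparableSpace A] (hp : p ≠ ∞) [SigmaFinite μ]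
    (π : ContractiveRep A (Lp ℂ p μ)) {C : Set (Lp ℂ p μ)} (hC : C.Countable) :
    ∃ (Y : Type u) (_ : MeasurableSpace Y) (ν : Measure Y) (_ : SigmaFinite ν)
      (_ : TopologicalSpace.SeparableSpace (Lp ℂ p ν)) (σ : ContractiveRep A (Lp ℂ p ν))
      (V : Lp ℂ p ν →ₗᵢ[ℂ] Lp ℂ p μ),
      (∀ a x, V (σ.hom a x) = π.hom a (V x)) ∧ C ⊆ Set.range V := by
  let T : ℕ → Lp ℂ p μ →L[ℂ] Lp ℂ p μ := fun k => π.hom (TopologicalSpace.denseSeq A k)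
  let S := μ.toFiniteSpanningSetsIn
  -- The closure operation puts the level sets of `T k 1_s` into `𝒜` whenever `s ∈ 𝒜`, so that each
  -- `T k` maps these indicators to functions measurable for the generated `σ`-algebra.
  obtain ⟨𝒜, hcount, halg, hmeas, hsub, hF⟩ := exists_countable_isSetAlgebra
    (𝒞 := Set.range S.set ∪ ⋃ f ∈ C, basisPreimages f)
    ((Set.countable_range _).union (hC.biUnion fun f _ => countable_basisPreimages f))
    (by
      rintro s (⟨k, rfl⟩ | hs)
      · exact S.set_mem k
      · obtain ⟨f, -, hs⟩ := Set.mem_iUnion₂.1 hs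
        exact measurableSet_of_mem_basisPreimages (Lp.stronglyMeasurable f).measurable hs)
    (fun s => ⋃ k, basisPreimages (T k (indicatorLp p μ s)))
    (fun s => Set.countable_iUnion fun k => countable_basisPreimages _)
    (fun s t ht => by
      obtain ⟨k, ht⟩ := Set.mem_iUnion.1 ht
      exact measurableSet_of_mem_basisPreimages (Lp.stronglyMeasurable _).measurable ht)
  have hm : MeasurableSpace.generateFrom 𝒜 ≤ mX := MeasurableSpace.generateFrom_le hmeas
  have hm' : ∀ s ∈ 𝒜, MeasurableSet[MeasurableSpace.generateFrom 𝒜] s := fun s =>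
    MeasurableSpace.measurableSet_generateFrom
  have hS : ∀ k, S.set k ∈ 𝒜 := fun k => hsub (Or.inl ⟨k, rfl⟩)
  -- A trimmed measure can fail to be `σ`-finite; the spanning sets were put into `𝒜` to prevent
  -- this.
  let S' : (μ.trim hm).FiniteSpanningSetsIn 𝒜 :=
    { set := S.set
      set_mem := hS
      finite := fun k => by rw [trim_measurableSet_eq hm (hm' _ (hS k))]; exact S.finite k
      spanning := S.spanning }
  have hσ : SigmaFinite (μ.trim hm) := S'.sigmaFinite
  have hsep := separableSpace_lp_of_generateFrom (p := p) hp hσ hcount rfl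
  have hcl : IsClosed (lpMeas ℂ ℂ (MeasurableSpace.generateFrom 𝒜) p μ : Set (Lp ℂ p μ)) :=
    isClosed_aestronglyMeasurable hm
  have hinv : ∀ a g, π.hom a (lpTrimIncl p μ hm g) ∈
      LinearMap.range (lpTrimIncl p μ hm).toLinearMap := by
    intro a g
    rw [range_lpTrimIncl]
    -- Two density arguments, both using that `lpMeas` is closed: first `a` is reduced to the dense
    -- sequence, then `g` to indicators of sets in `𝒜`.
    refine (TopologicalSpace.denseRange_denseSeq A).induction_on
      (p := fun a => π.hom a (lpTrimIncl p μ hm g) ∈ lpMeas ℂ ℂ _ p μ) a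
      (hcl.preimage (π.continuous_hom.clm_apply continuous_const)) fun k => ?_
    refine mem_of_forall_indicatorLp_mem hp halg rfl S'
      (K := (lpMeas ℂ ℂ (MeasurableSpace.generateFrom 𝒜) p μ).comap
        ((T k : Lp ℂ p μ →ₗ[ℂ] Lp ℂ p μ) ∘ₗ (lpTrimIncl p μ hm).toLinearMap))
      (hcl.preimage ((T k).continuous.comp (lpTrimIncl p μ hm).continuous)) (fun s hs => ?_) g
    change T k (lpTrimIncl p μ hm (indicatorLp p (μ.trim hm) s)) ∈
      lpMeas ℂ ℂ (MeasurableSpace.generateFrom 𝒜) p μ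
    rw [lpTrimIncl_indicatorLp hm (hm' s hs)]
    exact mem_lpMeas_of_basisPreimages rfl ((Set.subset_iUnion (fun k =>
      basisPreimages (T k (indicatorLp p μ s))) k).trans (hF s hs))
  obtain ⟨σ, hV⟩ := exists_subrep π (lpTrimIncl p μ hm) hinv
  refine ⟨X, _, μ.trim hm, hσ, hsep, σ, lpTrimIncl p μ hm, hV, fun f hf => ?_⟩
  have : f ∈ LinearMap.range (lpTrimIncl p μ hm).toLinearMap := by
    rw [range_lpTrimIncl]
    exact mem_lpMeas_of_basisPreimages rfl
      ((Set.subset_biUnion_of_mem (u := fun f : Lp ℂ p μ => basisPreimages f) hf).trans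
        (Set.subset_union_right.trans hsub))
  exact this

end Separable

/-! ### Comparison of matrix norms -/

section Comparison

variable {p : ℝ≥0∞} [Fact (1 ≤ p)] {A : Type w} [NonUnitalNormedRing A] [NormedSpace ℂ A]
  [TopologicalSpace.SeparableSpace A]

/-- Countably many vectors suffice to compute the norms of all operators of a representation of a
separable algebra: a subrepresentation containing them is isometric if the given one is. -/
theorem exists_countable_norming {E : Type*} [NormedAddCommGroup E] [NormedSpace ℂ E]
    (π : ContractiveRep A E) (hπ : π.IsIsometric) :
    ∃ C : Set E, C.Countable ∧ ∀ {F : Type u} [NormedAddCommGroup F] [NormedSpace ℂ F]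
      (σ : ContractiveRep A F) (V : F →ₗᵢ[ℂ] E), (∀ a x, V (σ.hom a x) = π.hom a (V x)) →
      C ⊆ Set.range V → σ.IsIsometric := by
  -- These almost norming vectors make up `C`. If `V` reaches them, `σ` inherits the lower bounds,
  -- so `‖a‖ ≤ ‖σ(a)‖` on a dense set of `a`, hence everywhere.
  have hex : ∀ k j : ℕ, ∃ x : E, ‖x‖ < 1 ∧ ‖TopologicalSpace.denseSeq A k‖ - 1 / (j + 1) <
      ‖π.hom (TopologicalSpace.denseSeq A k) x‖ := fun k j => by
    refine ContinuousLinearMap.exists_lt_apply_of_lt_opNorm _ ?_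
    rw [hπ]
    exact sub_lt_self _ Nat.one_div_pos_of_nat
  choose x hx1 hx using hex
  refine ⟨Set.range fun i : ℕ × ℕ => x i.1 i.2, Set.countable_range _, ?_⟩
  intro F _ _ σ V hV hC a
  refine (σ.norm_le a).antisymm ?_
  refine (TopologicalSpace.denseRange_denseSeq A).induction_on (p := fun a => ‖a‖ ≤ ‖σ.hom a‖) a
    (isClosed_le continuous_norm σ.continuous_hom.norm) fun k => ?_
  refine le_of_forall_pos_le_add fun ε hε => ?_
  obtain ⟨j, hj⟩ := exists_nat_one_div_lt hε
  obtain ⟨y, hy⟩ := hC ⟨(k, j), rfl⟩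
  simp only at hy
  have h1 : ‖y‖ ≤ 1 := by rw [← V.norm_map, hy]; exact (hx1 k j).le
  have h2 := hx k j
  rw [← hy, ← hV, V.norm_map] at h2
  have h3 := (σ.hom (TopologicalSpace.denseSeq A k)).le_of_opNorm_le_of_le le_rfl h1
  linarith

/-- If `A` has unique `L^p` operator matrix norms, the matrix norms of an isometric representation
dominate those of every contractive one. -/
theorem norm_amplify_le_of_isIsometric (hp : p ≠ ∞)
    (hunique : HasUniqueLpMatrixNorms.{u, w} p A) {X Y : Type u} [MeasurableSpace X]
    [MeasurableSpace Y] {μ : Measure X} {ν : Measure Y} [SigmaFinite μ] [SigmaFinite ν]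
    (π : ContractiveRep A (Lp ℂ p μ)) (hπ : π.IsIsometric) (σ : ContractiveRep A (Lp ℂ p ν))
    {n : ℕ} (a : Matrix (Fin n) (Fin n) A) : ‖amplify p σ a‖ ≤ ‖amplify p π a‖ := by
  obtain ⟨C, hC, hnorming⟩ := exists_countable_norming.{u} π hπ
  obtain ⟨X', _, μ', _, _, π', V, hV, hCV⟩ := exists_separable_subrep hp π hC
  have hπ' := hnorming π' V hV hCV
  -- The vector `x` is fixed before `σ` is cut down: `σ'` depends on `x` and need only contain its
  -- coordinates.
  refine ContinuousLinearMap.opNorm_le_bound _ (norm_nonneg _) fun x => ?_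
  obtain ⟨Y', _, ν', _, _, σ', W, hW, hCW⟩ :=
    exists_separable_subrep hp σ (Set.countable_range fun i => x i)
  have h0 : p ≠ 0 := ne_zero_of_fact p
  have hp' := toReal_pos_of_fact hp
  have hD := norm_rpow_lpSumEquiv (μ := μ') (ν := ν') h0 hp
  obtain ⟨τ, hτ, hI⟩ := exists_isometric_directSum hp' _ hD π' hπ' σ'
  have hsep := separableSpace_of_directSum hp' _ hD
  -- Here `τ = π' ⊕ σ'` contains `σ'` and is isometric because `π'` is. Uniqueness compares `τ` with
  -- `π'`, which is contained in `π`.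
  have hle : ‖amplify p σ' a‖ ≤ ‖amplify p π a‖ :=
    calc ‖amplify p σ' a‖ ≤ ‖amplify p τ a‖ := norm_amplify_le_of_intertwine hp _ hI a
      _ = ‖amplify p π' a‖ := hunique X' (X' ⊕ Y') μ' (sumMeasure μ' ν') π' τ hπ' hτ n a
      _ ≤ ‖amplify p π a‖ := norm_amplify_le_of_intertwine hp V hV a
  choose y hy using fun i => hCW ⟨i, rfl⟩
  have hxy : x = WithLp.toLp p fun i => W ((WithLp.toLp p y : PiLp p fun _ => Lp ℂ p ν') i) := by
    ext1 i; exact (hy i).symm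
  rw [hxy, amplify_toLp_map W hW, norm_toLp_map hp, norm_toLp_map hp]
  exact ContinuousLinearMap.le_of_opNorm_le _ hle _

end Comparison

/-! ### The extension to the completion -/

section Extension

open UniformSpace

variable {p : ℝ≥0∞} [Fact (1 ≤ p)] {G : Type v} {A : Type w} [Group G]
  [NonUnitalNormedRing A] [NormedSpace ℂ A] {α : IsometricAction G A} {E : Type*}
  [NormedAddCommGroup E] [NormedSpace ℂ E] [CompleteSpace E]

/-- If the integrated form is isometric on `C_c(G, A, α)`, it extends to an isometric representation
of the reduced crossed product. -/
theorem exists_isometric_extension (π : ContractiveRep A E)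
    (h : ∀ f : Cc.{u, v, w} p α, ‖integratedForm π f‖ = ‖f‖) :
    ∃ Φ : ReducedCrossedProduct.{u, v, w} p α →ₙₐ[ℂ] (lpG p G E →L[ℂ] lpG p G E),
      (∀ f : Cc.{u, v, w} p α, Φ f = integratedForm π f) ∧ ∀ x, ‖Φ x‖ = ‖x‖ := by
  have hu : UniformContinuous (integratedForm (p := p) (α := α) π :
      Cc.{u, v, w} p α → (lpG p G E →L[ℂ] lpG p G E)) :=
    uniformContinuous_addMonoidHom_of_continuous
      (AddMonoidHomClass.continuous_of_bound (integratedForm π) 1 fun f => by rw [h, one_mul])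
  -- The extension exists because `E`, hence the operator algebra on `l^p(G, E)`, is complete. The
  -- algebraic laws and the norm identity are closed conditions, inherited from `C_c(G, A, α)`.
  let φ : ReducedCrossedProduct.{u, v, w} p α → (lpG p G E →L[ℂ] lpG p G E) :=
    Completion.extension (integratedForm π)
  have hφ : ∀ f : Cc.{u, v, w} p α, φ f = integratedForm π f := Completion.extension_coe hu
  have hc : Continuous φ := Completion.continuous_extension
  refine ⟨{ toFun := φ, map_smul' := fun c x => ?_, map_zero' := ?_, map_add' := fun x y => ?_,
            map_mul' := fun x y => ?_ }, hφ, fun x => ?_⟩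
  · exact Completion.induction_on x
      (isClosed_eq (hc.comp (continuous_const_smul c)) (hc.const_smul c)) fun f => by
        rw [← Completion.coe_smul, hφ, hφ, map_smul]; rfl
  · rw [← Completion.coe_zero, hφ, map_zero]
  · exact Completion.induction_on₂ x y (isClosed_eq (by fun_prop) (by fun_prop)) fun f g => by
      rw [← Completion.coe_add, hφ, hφ, hφ, map_add]
  · exact Completion.induction_on₂ x y (isClosed_eq (by fun_prop) (by fun_prop)) fun f g => by
      rw [← coe_mul, hφ, hφ, hφ, map_mul]
  · exact Completion.induction_on x (isClosed_eq hc.norm continuous_norm) fun f =>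
      (congrArg norm (hφ f)).trans ((h f).trans (Completion.norm_coe f).symm)

end Extension

end LpCrossed

end

/-! ### The reduced norm is attained at every nondegenerate isometric representation -/

theorem lemma2p5 (p : ℝ≥0∞) [Fact (1 ≤ p)] (hp : p ≠ ∞)
    {G : Type v} [Group G] [Countable G]
    {A : Type w} [NonUnitalNormedRing A] [NormedSpace ℂ A] [IsScalarTower ℂ A A]
    [SMulCommClass ℂ A A] [CompleteSpace A] [TopologicalSpace.SeparableSpace A]
    (hA : LpCrossed.IsLpOperatorAlgebra.{u, w} p A)
    (hunique : LpCrossed.HasUniqueLpMatrixNorms.{u, w} p A)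
    (α : LpCrossed.IsometricAction G A)
    {X : Type u} [MeasurableSpace X] (μ : Measure X) [SigmaFinite μ]
    (π₀ : LpCrossed.ContractiveRep A (Lp ℂ p μ))
    (hnd : π₀.Nondegenerate) (hiso : π₀.IsIsometric) :
    ∃ Φ : LpCrossed.ReducedCrossedProduct.{u, v, w} p α →ₙₐ[ℂ]
        (LpCrossed.lpG p G (Lp ℂ p μ) →L[ℂ] LpCrossed.lpG p G (Lp ℂ p μ)),
      (∀ f : LpCrossed.Cc.{u, v, w} p α, Φ f = LpCrossed.integratedForm π₀ f) ∧
      ∀ x, ‖Φ x‖ = ‖x‖ := by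
  -- Nondegeneracy places `π₀` among the representations in the supremum, which gives one
  -- inequality. For the other, each competitor `σ` is compared with `π₀` section by section.
  refine LpCrossed.exists_isometric_extension π₀ fun f =>
    (LpCrossed.norm_le_reducedNorm f μ π₀ hnd).antisymm ?_
  refine LpCrossed.reducedNorm_le f fun Y _ ν _ σ _ => ?_
  exact LpCrossed.norm_integratedForm_le_of_amplify_le hp σ f (norm_nonneg _) fun n e he =>
    (LpCrossed.norm_amplify_le_of_isIsometric hp hunique π₀ hiso σ _).trans
      (LpCrossed.norm_amplify_sectionMatrix_le hp π₀ f he)
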